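/- Throughout, a linear algebraic group is a Zariski closed subgroup of some $GL_n(\mathbb{C})$, and $Z_G(S)$ denotes the centralizer in $G$ of a subset (or element) $S$. Let $G$ be a complex reductive group, i.e. a linear algebraic group over $\mathbb{C}$ with trivial unipotent radical, and let $T \subset G$ be a maximal torus. The parabolic subgroups of $G$ are the subgroups $P_G(\gamma)=\{g\in G : \lim_{z\to 0}\gamma(z)g\gamma(z)^{-1} \text{ exists in } G\}$ for cocharacters $\gamma\colon\mathbb{C}^\times\to G$, and the Levi subgroups of a parabolic subgroup $P$ are the centralizers $Z_G(\gamma(\mathbb{C}^\times))$ for those $\gamma$ with $P=P_G(\gamma)$ (for connected $G$ these are the usual parabolic subgroups and Levi subgroups). 1. Let $H$ be a Levi subgroup of a parabolic subgroup of $G$ with $T\subset H$, and let $Z\subset T$ be a torus with $Z_G(Z)=H$. Then for any $H$-conjugacy class $\mathcal{C}\subset H$, the set of $t\in Z$ satisfying both (i) $Z_G(t)=H$, and (ii) $Z_G(ht^{-1})\subset H$ for all $h\in\mathcal{C}$, contains a (Zariski) open dense subset of $Z$. 2. For every Levi subgroup $H\supset T$ of a parabolic subgroup of $G$ there is a torus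 $Z\subset T$ with $Z_G(Z)=H$. 3. Hence unfolding parameters always exist: let $r\ge 1$, let $H_1\subset H_2\subset\dots\subset H_r$ be an increasing sequence of subgroups containing $T$, each of which is a Levi subgroup of a parabolic subgroup of $G$, and let $\mathcal{C}\subset H_1$ be an $H_1$-conjugacy class. Then there are $t_1,\dots,t_r\in T$ such that $Z_G(t_i)=H_i$ for all $i=1,\dots,r$ and $Z_G(h(t_1t_2\cdots t_r)^{-1})\subset H_1$ for all $h\in\mathcal{C}$. -/

import Mathlib

open scoped MatrixGroups Topology

/-!
Complex linear algebraic groups are treated as Zariski closed subgroups of `GL (Fin n) ℂ`,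
and identified with their groups of complex points.
-/

namespace AlgGrp

/-- The Zariski topology of `GL_n(ℂ)`: the sets `{g | p (entries of g) ≠ 0}`, for `p` a polynomial
in the `n²` matrix entries, form a basis of open sets.  (As `det` is itself such a polynomial,
allowing `1 / det` as a further coordinate gives the same topology.) -/
@[reducible]
def zariski (n : ℕ) : TopologicalSpace (GL (Fin n) ℂ) :=
  TopologicalSpace.generateFrom
    {U | ∃ p : MvPolynomial (Fin n × Fin n) ℂ,
      U = {g : GL (Fin n) ℂ | MvPolynomial.eval (fun ij => (g : Matrix (Fin n) (Fin n) ℂ) ij.1 ij.2) p ≠ 0}}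

variable {n : ℕ}

/-- A linear algebraic group: a Zariski closed subgroup of `GL_n(ℂ)`. -/
def IsAlgebraic (G : Subgroup (GL (Fin n) ℂ)) : Prop :=
  IsClosed[zariski n] (G : Set (GL (Fin n) ℂ))

/-- Connectedness of a subgroup in the Zariski topology. -/
def IsConnectedGroup (G : Subgroup (GL (Fin n) ℂ)) : Prop :=
  @IsConnected _ (zariski n) (G : Set (GL (Fin n) ℂ))

/-- A subgroup all of whose elements are unipotent. -/
def IsUnipotentGroup (U : Subgroup (GL (Fin n) ℂ)) : Prop :=
  ∀ u ∈ U, IsNilpotent ((u : Matrix (Fin n) (Fin n) ℂ) - 1)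

/-- A complex reductive group: a linear algebraic group whose unipotent radical is trivial, that is,
in which every connected unipotent normal algebraic subgroup is trivial. -/
def IsReductive (G : Subgroup (GL (Fin n) ℂ)) : Prop :=
  IsAlgebraic G ∧
    ∀ U : Subgroup (GL (Fin n) ℂ), U ≤ G → IsAlgebraic U → IsConnectedGroup U →
      IsUnipotentGroup U → (∀ g ∈ G, ∀ u ∈ U, g * u * g⁻¹ ∈ U) → U = ⊥

/-- An algebraic torus: a connected diagonalizable algebraic group. -/
def IsTorus (S : Subgroup (GL (Fin n) ℂ)) : Prop :=
  IsAlgebraic S ∧ IsConnectedGroup S ∧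
    ∃ b : GL (Fin n) ℂ, ∀ s ∈ S, ((b * s * b⁻¹ : GL (Fin n) ℂ) : Matrix (Fin n) (Fin n) ℂ).IsDiag

/-- `T` is a maximal torus of `G`. -/
def IsMaximalTorus (G T : Subgroup (GL (Fin n) ℂ)) : Prop :=
  IsTorus T ∧ T ≤ G ∧ ∀ S : Subgroup (GL (Fin n) ℂ), IsTorus S → S ≤ G → T ≤ S → S = T

/-- The centralizer `Z_G(S)` in `G` of a set `S`. -/
def centralizerIn (G : Subgroup (GL (Fin n) ℂ)) (S : Set (GL (Fin n) ℂ)) :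
    Subgroup (GL (Fin n) ℂ) :=
  G ⊓ Subgroup.centralizer S

/-- A cocharacter of `G`: a homomorphism `ℂˣ → G` of algebraic groups, that is, a group homomorphism
whose matrix entries are Laurent polynomials `p(z) / z ^ k`. -/
def IsCocharacter (G : Subgroup (GL (Fin n) ℂ)) (γ : ℂˣ →* GL (Fin n) ℂ) : Prop :=
  (∀ z, γ z ∈ G) ∧
    ∀ i j, ∃ (p : Polynomial ℂ) (k : ℕ), ∀ z : ℂˣ,
      (γ z : Matrix (Fin n) (Fin n) ℂ) i j = p.eval (z : ℂ) / (z : ℂ) ^ k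

/-- `P_G(γ)`: the group of all `g ∈ G` for which `γ(z) g γ(z)⁻¹` has a limit in `G` as `z → 0`. -/
def limitSubgroup (G : Subgroup (GL (Fin n) ℂ)) (γ : ℂˣ →* GL (Fin n) ℂ) :
    Subgroup (GL (Fin n) ℂ) where
  carrier := {g | g ∈ G ∧ ∃ l ∈ G, Filter.Tendsto (fun z : ℂˣ => γ z * g * (γ z)⁻¹)
    (Filter.comap (fun z : ℂˣ => (z : ℂ)) (𝓝 0)) (𝓝 l)}
  one_mem' := ⟨G.one_mem, 1, G.one_mem, by simpa using tendsto_const_nhds⟩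
  mul_mem' := by
    rintro a b ⟨ha, l, hl, hla⟩ ⟨hb, m, hm, hmb⟩
    refine ⟨G.mul_mem ha hb, l * m, G.mul_mem hl hm, ?_⟩
    refine (hla.mul hmb).congr fun z => ?_
    group
  inv_mem' := by
    rintro a ⟨ha, l, hl, hla⟩
    refine ⟨G.inv_mem ha, l⁻¹, G.inv_mem hl, ?_⟩
    refine hla.inv.congr fun z => ?_
    group

/-- `P` is a parabolic subgroup of the reductive group `G`: it is of the form `P_G(γ)` for a
cocharacter `γ` of `G`. -/
def IsParabolic (G P : Subgroup (GL (Fin n) ℂ)) : Prop :=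
  ∃ γ : ℂˣ →* GL (Fin n) ℂ, IsCocharacter G γ ∧ P = limitSubgroup G γ

/-- `H` is a Levi subgroup of the parabolic subgroup `P` of the reductive group `G`: for some
cocharacter `γ` with `P = P_G(γ)`, it is the centralizer of the image of `γ`.
(Conjugating `γ` by elements of the unipotent radical of `P` does not change `P_G(γ)`, and
gives all the Levi subgroups of `P`.) -/
def IsLeviOf (G P H : Subgroup (GL (Fin n) ℂ)) : Prop :=
  ∃ γ : ℂˣ →* GL (Fin n) ℂ, IsCocharacter G γ ∧ P = limitSubgroup G γ ∧
    H = centralizerIn G (Set.range γ)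

/-- `C` is an `H`-conjugacy class in `H`. -/
def IsConjClassOf (H : Subgroup (GL (Fin n) ℂ)) (C : Set (GL (Fin n) ℂ)) : Prop :=
  ∃ c ∈ H, C = {h | ∃ k ∈ H, h = k * c * k⁻¹}

/-- `U` is an open dense subset of `Z` (with the Zariski topology induced from `GL_n(ℂ)`). -/
def IsOpenDenseIn (U Z : Set (GL (Fin n) ℂ)) : Prop :=
  (∃ O : Set (GL (Fin n) ℂ), IsOpen[zariski n] O ∧ U = Z ∩ O) ∧ Z ⊆ closure[zariski n] U

end AlgGrp

/-!
No structure theory of reductive groups is needed; the proof rests on weight decompositions and on the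
irreducibility of tori.

Let `Z` be a torus with weights `d i`, and let `c` commute with `Z`, so that `c` is block diagonal for
the decomposition of `ℂⁿ` into weight spaces of `Z`. For `t ∈ Z`, the matrix `c t⁻¹` acts on the
weight space of `d i` with eigenvalues `x / d i t`, where `x` is an eigenvalue of `c`. If eigenvalues
coming from different weight spaces never coincide, then each weight space is a sum of generalized
eigenspaces of `c t⁻¹`, so that every matrix commuting with `c t⁻¹` preserves it, which means that it
commutes with `Z`. This is `apply_eq_zero_of_commute`, in the form of a Sylvester equation for the
off-diagonal blocks. The condition on `t` consists of finitely many inequalities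
`d i t * x ≠ d j t * y`, each of which defines an open subset meeting `Z`, as
`exists_isOpen_centralizer_le` shows. A torus is irreducible, being connected
(`isPreirreducible_of_isPreconnected`), so the intersection is open and dense in `Z`. Applied to `1` and
to a representative of the conjugacy class, this gives the first part.

For the second part, let `H` be the centralizer of the image of a cocharacter `γ` and contain the
maximal torus `T`. Then `γ` commutes with `T`, the group `T · γ(ℂˣ)` is connected and diagonalizable,
and maximality of `T` gives `γ(ℂˣ) ⊆ T` (`IsMaximalTorus.cocharacter_mem`). The Zariski closure of
`γ(ℂˣ)` is the required torus.

For the third part, `t₂, …, tᵣ` are chosen generically in tori belonging to `H₂, …, Hᵣ`. Their product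
`s` is central in `H₁`, so that `C s⁻¹` is again a conjugacy class of `H₁`, and the first part for this
class provides `t₁`.
-/

namespace AlgGrp

/-! ### Connected groups with a Noetherian topology are irreducible -/

section Irreducible

variable {Γ : Type*} [Group Γ] [TopologicalSpace Γ] [SeparatelyContinuousMul Γ]
  [TopologicalSpace.NoetherianSpace Γ]

/-- Some irreducible component has nonempty interior. Its translates make the group locally
irreducible, which forces the closure of a nonempty irreducible open set to be open as well. -/
theorem preirreducibleSpace_of_preconnectedSpace [PreconnectedSpace Γ] :
    PreirreducibleSpace Γ := by
  obtain ⟨U, hUo, hUne, hUi⟩ : ∃ U : Set Γ, IsOpen U ∧ U.Nonempty ∧ IsPreirreducible U := by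
    obtain ⟨U, hU, hne, hle⟩ := 
      TopologicalSpace.NoetherianSpace.exists_isOpen_nonempty_subset_irreducibleComponent
        (irreducibleComponent (1 : Γ)) (irreducibleComponent_mem_irreducibleComponents 1)
    exact ⟨U, hU, hne,
      (isIrreducible_irreducibleComponent.isPreirreducible).open_subset hU hle⟩
  have key : IsOpen (closure U) := by
    rw [isOpen_iff_mem_nhds]
    intro y hy
    obtain ⟨u, hu⟩ := hUne
    -- the translate of `U` containing `y`
    set V : Set Γ := (fun x => (y * u⁻¹) * x) '' U with hV
    have hVo : IsOpen V := (Homeomorph.mulLeft (y * u⁻¹)).isOpenMap _ hUo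
    have hyV : y ∈ V := ⟨u, hu, by simp⟩
    have hVi : IsPreirreducible V := hUi.image _ (continuous_const_mul _).continuousOn
    refine Filter.mem_of_superset (hVo.mem_nhds hyV) ?_
    have hne : (V ∩ U).Nonempty := mem_closure_iff.1 hy V hVo hyV
    exact (subset_closure_inter_of_isPreirreducible_of_isOpen hVi hUo hne).trans
      (closure_mono Set.inter_subset_right)
  have huniv : closure U = Set.univ :=
    IsClopen.eq_univ ⟨isClosed_closure, key⟩ hUne.closure
  exact ⟨huniv ▸ hUi.closure⟩

theorem isPreirreducible_of_isPreconnected (Z : Subgroup Γ) (hZ : IsPreconnected (Z : Set Γ)) :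
    IsPreirreducible (Z : Set Γ) := by
  have : PreconnectedSpace Z := isPreconnected_iff_preconnectedSpace.1 hZ
  have : TopologicalSpace.NoetherianSpace Z := TopologicalSpace.NoetherianSpace.set (Z : Set Γ)
  have : SeparatelyContinuousMul Z :=
    { continuous_const_mul := fun {a} =>
        ((continuous_const_mul (a : Γ)).comp continuous_subtype_val).subtype_mk _
      continuous_mul_const := fun {a} =>
        ((continuous_mul_const (a : Γ)).comp continuous_subtype_val).subtype_mk _ }
  exact isPreirreducible_iff_preirreducibleSpace.2
    (preirreducibleSpace_of_preconnectedSpace (Γ := Z))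

end Irreducible

section Closure

variable {Γ : Type*} [Group Γ] [TopologicalSpace Γ] [SeparatelyContinuousMul Γ]

theorem mul_mem_closure_subgroup (S : Subgroup Γ) {a b : Γ} (ha : a ∈ closure (S : Set Γ))
    (hb : b ∈ closure (S : Set Γ)) : a * b ∈ closure (S : Set Γ) := by
  -- multiplication need not be jointly continuous, so the factors are moved one at a time
  have h1 : ∀ s ∈ S, s * b ∈ closure (S : Set Γ) := fun s hs =>
    map_mem_closure (continuous_const_mul s) hb fun x hx => S.mul_mem hs hx
  have := map_mem_closure (continuous_mul_const b) ha h1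
  rwa [closure_closure] at this

/-- The closure of a subgroup, for a topology in which multiplication is only separately
continuous. -/
def closureSubgroup [ContinuousInv Γ] (S : Subgroup Γ) : Subgroup Γ where
  carrier := closure (S : Set Γ)
  one_mem' := subset_closure S.one_mem
  mul_mem' := mul_mem_closure_subgroup S
  inv_mem' h := map_mem_closure continuous_inv h fun _ hx => S.inv_mem hx

end Closure

/-! ### The Zariski topology -/

variable {n : ℕ}

local notation "Mat" n => Matrix (Fin n) (Fin n) ℂ

/-- The value of a polynomial in the matrix entries at a matrix. -/
noncomputable def evalAt (M : Mat n) : MvPolynomial (Fin n × Fin n) ℂ →+* ℂ :=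
  MvPolynomial.eval fun ij => M ij.1 ij.2

/-- The Zariski topology is the one induced by sending a matrix to the corresponding maximal ideal of
the polynomial ring, so that it inherits Noetherianity from the prime spectrum. -/
theorem zariski_eq_induced : zariski n = TopologicalSpace.induced
    (fun g : GL (Fin n) ℂ => (⟨RingHom.ker (evalAt (g : Mat n)), RingHom.ker_isPrime _⟩ :
      PrimeSpectrum (MvPolynomial (Fin n × Fin n) ℂ))) inferInstance := by
  rw [(PrimeSpectrum.isTopologicalBasis_basic_opens).eq_generateFrom, induced_generateFrom_eq]
  unfold zariski
  congr 1
  ext U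
  constructor
  · rintro ⟨p, rfl⟩
    exact ⟨_, ⟨p, rfl⟩, rfl⟩
  · rintro ⟨_, ⟨p, rfl⟩, rfl⟩
    exact ⟨p, rfl⟩

theorem noetherianSpace_zariski : @TopologicalSpace.NoetherianSpace _ (zariski n) := by
  let := zariski n
  exact Topology.IsInducing.noetherianSpace ⟨zariski_eq_induced⟩

theorem isOpen_zariski_ne (p : MvPolynomial (Fin n × Fin n) ℂ) :
    IsOpen[zariski n] {g : GL (Fin n) ℂ | evalAt (g : Mat n) p ≠ 0} :=
  TopologicalSpace.isOpen_generateFrom_of_mem ⟨p, rfl⟩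

theorem isClosed_zariski_eq (p : MvPolynomial (Fin n × Fin n) ℂ) :
    IsClosed[zariski n] {g : GL (Fin n) ℂ | evalAt (g : Mat n) p = 0} := by
  let := zariski n
  exact isOpen_compl_iff.1 (isOpen_zariski_ne p)

theorem continuous_zariski_of_forall {X : Type*} [TopologicalSpace X] {f : X → GL (Fin n) ℂ}
    (h : ∀ p, IsOpen {x | evalAt (f x : Mat n) p ≠ 0}) :
    Continuous[inferInstance, zariski n] f := by
  refine continuous_generateFrom_iff.2 ?_
  rintro _ ⟨p, rfl⟩
  exact h p

/-- Two-sided multiplication by fixed matrices is a polynomial map. -/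
theorem exists_evalAt_mul_mul (A B : Mat n) (p : MvPolynomial (Fin n × Fin n) ℂ) :
    ∃ q, ∀ M : Mat n, evalAt M q = evalAt (A * M * B) p := by
  set X := Matrix.mvPolynomialX (Fin n) (Fin n) ℂ with hX
  let Y : Matrix (Fin n) (Fin n) (MvPolynomial (Fin n × Fin n) ℂ) :=
    A.map MvPolynomial.C * X * B.map MvPolynomial.C
  refine ⟨MvPolynomial.bind₁ (fun ij => Y ij.1 ij.2) p, fun M => ?_⟩
  have hM : (evalAt M).mapMatrix Y = A * M * B := by
    have hC : ∀ A : Mat n, (evalAt M).mapMatrix (A.map MvPolynomial.C) = A := fun A => by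
      ext i j
      simp [evalAt]
    rw [map_mul, map_mul, hC, hC, evalAt, hX, Matrix.mvPolynomialX_mapMatrix_eval]
  have h : (evalAt M).comp (MvPolynomial.bind₁ fun ij : Fin n × Fin n => Y ij.1 ij.2).toRingHom =
      evalAt (A * M * B) := by
    refine MvPolynomial.ringHom_ext (fun r => by simp [evalAt]) fun ij => ?_
    rw [← hM]
    simp [evalAt]
  exact congrArg (fun φ => φ p) h

/-- Up to a power of the determinant, inversion is a polynomial map. -/
theorem exists_evalAt_inv (p : MvPolynomial (Fin n × Fin n) ℂ) :
    ∃ (q : MvPolynomial (Fin n × Fin n) ℂ) (N : ℕ), ∀ g : GL (Fin n) ℂ,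
      evalAt (g : Mat n) q = (g : Mat n).det ^ N * evalAt ((g⁻¹ : GL (Fin n) ℂ) : Mat n) p := by
  obtain ⟨D, hD⟩ : ∃ D, ∀ M : Mat n, evalAt M D = M.det := by
    refine ⟨(Matrix.mvPolynomialX (Fin n) (Fin n) ℂ).det, fun M => ?_⟩
    rw [evalAt, RingHom.map_det, Matrix.mvPolynomialX_mapMatrix_eval]
  induction p using MvPolynomial.induction_on with
  | C a => exact ⟨MvPolynomial.C a, 0, fun g => by simp [evalAt]⟩
  | add p₁ p₂ h₁ h₂ =>
    obtain ⟨q₁, N₁, h₁⟩ := h₁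
    obtain ⟨q₂, N₂, h₂⟩ := h₂
    refine ⟨D ^ N₂ * q₁ + D ^ N₁ * q₂, N₁ + N₂, fun g => ?_⟩
    simp only [map_add, map_mul, map_pow, hD, h₁, h₂]
    ring
  | mul_X p ij h =>
    obtain ⟨q, N, h⟩ := h
    refine ⟨q * (Matrix.mvPolynomialX (Fin n) (Fin n) ℂ).adjugate ij.1 ij.2, N + 1, fun g => ?_⟩
    have hadj : evalAt (g : Mat n) ((Matrix.mvPolynomialX (Fin n) (Fin n) ℂ).adjugate ij.1 ij.2) =
        (g : Mat n).adjugate ij.1 ij.2 := by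
      have := RingHom.map_adjugate (evalAt (g : Mat n)) (Matrix.mvPolynomialX (Fin n) (Fin n) ℂ)
      rw [evalAt, Matrix.mvPolynomialX_mapMatrix_eval] at this
      rw [← this]
      rfl
    have hinv : (g : Mat n).adjugate ij.1 ij.2 =
        (g : Mat n).det * ((g⁻¹ : GL (Fin n) ℂ) : Mat n) ij.1 ij.2 := by
      have hdet : (g : Mat n).det ≠ 0 := ((Matrix.isUnit_iff_isUnit_det _).1 g.isUnit).ne_zero
      rw [Matrix.coe_units_inv, Matrix.inv_def]
      simp [hdet]
    have hX : evalAt ((g⁻¹ : GL (Fin n) ℂ) : Mat n) (MvPolynomial.X ij) =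
      ((g⁻¹ : GL (Fin n) ℂ) : Mat n) ij.1 ij.2 := by simp [evalAt]
    rw [map_mul, map_mul, h, hadj, hinv, hX]
    ring

theorem continuous_zariski_mul_mul (a b : GL (Fin n) ℂ) :
    Continuous[zariski n, zariski n] fun g => a * g * b := by
  let := zariski n
  refine continuous_zariski_of_forall fun p => ?_
  obtain ⟨q, hq⟩ := exists_evalAt_mul_mul (a : Mat n) (b : Mat n) p
  simpa only [Units.val_mul, ← hq] using isOpen_zariski_ne q

theorem separatelyContinuousMul_zariski :
    @SeparatelyContinuousMul (GL (Fin n) ℂ) (zariski n) _ := by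
  let := zariski n
  exact ⟨fun {a} => by simpa using continuous_zariski_mul_mul a 1,
    fun {a} => by simpa using continuous_zariski_mul_mul 1 a⟩

theorem continuousInv_zariski : @ContinuousInv (GL (Fin n) ℂ) (zariski n) _ := by
  let := zariski n
  refine ⟨continuous_zariski_of_forall fun p => ?_⟩
  obtain ⟨q, N, hq⟩ := exists_evalAt_inv p
  convert isOpen_zariski_ne q using 3 with g
  have hdet : (g : Mat n).det ≠ 0 := ((Matrix.isUnit_iff_isUnit_det _).1 g.isUnit).ne_zero
  simp [hq, hdet]

theorem IsConnectedGroup.isPreirreducible {Z : Subgroup (GL (Fin n) ℂ)} (hZ : IsConnectedGroup Z) :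
    @IsPreirreducible _ (zariski n) (Z : Set (GL (Fin n) ℂ)) := by
  let := zariski n
  have := noetherianSpace_zariski (n := n)
  have := separatelyContinuousMul_zariski (n := n)
  exact isPreirreducible_of_isPreconnected Z hZ.isPreconnected

/-- The Zariski closure of a subgroup. -/
noncomputable def zariskiClosure (S : Subgroup (GL (Fin n) ℂ)) : Subgroup (GL (Fin n) ℂ) :=
  @closureSubgroup _ _ (zariski n) separatelyContinuousMul_zariski continuousInv_zariski S

theorem le_zariskiClosure (S : Subgroup (GL (Fin n) ℂ)) : S ≤ zariskiClosure S :=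
  @subset_closure _ (zariski n) _

theorem isAlgebraic_zariskiClosure (S : Subgroup (GL (Fin n) ℂ)) :
    IsAlgebraic (zariskiClosure S) :=
  @isClosed_closure _ (zariski n) _

theorem zariskiClosure_subset {S : Subgroup (GL (Fin n) ℂ)} {F : Set (GL (Fin n) ℂ)}
    (hF : IsClosed[zariski n] F) (h : (S : Set (GL (Fin n) ℂ)) ⊆ F) :
    (zariskiClosure S : Set (GL (Fin n) ℂ)) ⊆ F :=
  @closure_minimal _ (zariski n) _ _ h hF

theorem isClosed_zariski_mul_mul_apply (A B : Mat n) (i j : Fin n) :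
    IsClosed[zariski n] {g : GL (Fin n) ℂ | (A * (g : Mat n) * B) i j = 0} := by
  obtain ⟨q, hq⟩ := exists_evalAt_mul_mul A B (MvPolynomial.X (i, j))
  have := isClosed_zariski_eq q
  simp only [hq] at this
  simpa [evalAt] using this

theorem isClosed_zariski_isDiag (b : GL (Fin n) ℂ) :
    IsClosed[zariski n] {g : GL (Fin n) ℂ | ((b * g * b⁻¹ : GL (Fin n) ℂ) : Mat n).IsDiag} := by
  let := zariski n
  simp only [Matrix.IsDiag, Pairwise, Set.ofPred_forall]
  exact isClosed_iInter fun i => isClosed_iInter fun j => isClosed_iInter fun _ =>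
    isClosed_zariski_mul_mul_apply _ _ i j

theorem isClosed_zariski_commute (a : GL (Fin n) ℂ) :
    IsClosed[zariski n] {g : GL (Fin n) ℂ | g * a = a * g} := by
  let := zariski n
  have h : {g : GL (Fin n) ℂ | g * a = a * g} = ⋂ i, ⋂ j, {g : GL (Fin n) ℂ |
      evalAt (g : Mat n) ((exists_evalAt_mul_mul 1 (a : Mat n) (.X (i, j))).choose -
        (exists_evalAt_mul_mul (a : Mat n) 1 (.X (i, j))).choose) = 0} := by
    ext g
    simp only [Set.mem_iInter, Set.mem_ofPred_eq, map_sub,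
      (exists_evalAt_mul_mul 1 (a : Mat n) (.X (_, _))).choose_spec,
      (exists_evalAt_mul_mul (a : Mat n) 1 (.X (_, _))).choose_spec]
    rw [← Units.val_inj, ← Matrix.ext_iff]
    simp [evalAt, sub_eq_zero]
  rw [h]
  exact isClosed_iInter fun i => isClosed_iInter fun j => isClosed_zariski_eq _

theorem centralizerIn_zariskiClosure (G S : Subgroup (GL (Fin n) ℂ)) :
    centralizerIn G (zariskiClosure S : Set (GL (Fin n) ℂ)) =
      centralizerIn G (S : Set (GL (Fin n) ℂ)) := by
  refine le_antisymm (inf_le_inf le_rfl (Subgroup.centralizer_le (le_zariskiClosure S))) ?_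
  refine inf_le_inf le_rfl fun g hg => ?_
  rw [Subgroup.mem_centralizer_iff] at hg ⊢
  exact zariskiClosure_subset (isClosed_zariski_commute g) hg

/-! ### Matrices commuting with a generic translate -/

/-- The homogeneous Sylvester equation has only the zero solution if the coefficients have
disjoint spectra. -/
theorem eq_zero_of_mul_eq_mul_of_disjoint_spectrum {C D N : Mat n} (h : C * N = N * D)
    (hCD : Disjoint (spectrum ℂ C) (spectrum ℂ D)) : N = 0 := by
  rcases isEmpty_or_nonempty (Fin n) with hn | hn
  · exact Subsingleton.elim _ _
  have hp : ∀ p : Polynomial ℂ, Polynomial.aeval C p * N = N * Polynomial.aeval D p := by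
    intro p
    induction p using Polynomial.induction_on' with
    | add p q hp hq => simp [add_mul, mul_add, hp, hq]
    | monomial k a =>
      have hk : C ^ k * N = N * D ^ k :=
        (SemiconjBy.pow_right (show SemiconjBy N D C from h.symm) k).eq.symm
      simp [Polynomial.aeval_monomial, Algebra.algebraMap_eq_smul_one, hk]
  have h0 := hp C.charpoly
  rw [Matrix.aeval_self_charpoly, zero_mul] at h0
  have hu : IsUnit (Polynomial.aeval D C.charpoly) := by
    by_contra hu
    rw [← spectrum.zero_mem_iff ℂ, spectrum.map_polynomial_aeval_of_degree_pos] at hu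
    · obtain ⟨x, hx, hx0⟩ := hu
      exact Set.disjoint_left.1 hCD (Matrix.mem_spectrum_iff_isRoot_charpoly.2 hx0) hx
    · rw [Matrix.charpoly_degree_eq_dim]
      exact_mod_cast Fintype.card_pos
  exact (hu.mul_left_eq_zero).1 h0.symm

/-- Let `C` be block diagonal for the partition of the indices given by `d`, and let the scalars `τ`,
constant on the blocks, satisfy `τ i * x ≠ τ j * y` for all `i`, `j` in different blocks and all
eigenvalues `x`, `y` of `C`. Then a matrix commuting with `C * diagonal τ⁻¹` is block diagonal: its
block `N` at `(i, j)` satisfies `C N = (τ i / τ j) N C`. -/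
theorem apply_eq_zero_of_commute {ι : Type*} (d : Fin n → ι) {C Y : Mat n} {τ : Fin n → ℂ}
    (hτ : ∀ i, τ i ≠ 0) (hd : ∀ i j, d i = d j → τ i = τ j)
    (hC : ∀ i j, d i ≠ d j → C i j = 0)
    (hgen : ∀ i j, d i ≠ d j → ∀ x ∈ spectrum ℂ C, ∀ y ∈ spectrum ℂ C, τ i * x ≠ τ j * y)
    (hY : Y * (C * Matrix.diagonal τ⁻¹) = C * Matrix.diagonal τ⁻¹ * Y)
    {i j : Fin n} (hij : d i ≠ d j) : Y i j = 0 := by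
  classical
  let e : Fin n → Mat n := fun i => Matrix.diagonal fun k => if d k = d i then 1 else 0
  have heC : ∀ i, e i * C = C * e i := fun i => by
    ext k l
    simp only [e, Matrix.diagonal_mul, Matrix.mul_diagonal]
    by_cases hkl : d k = d l
    · simp [hkl, mul_comm]
    · simp [hC k l hkl]
  have hex : e i * (C * Matrix.diagonal τ⁻¹) = (τ i)⁻¹ • (e i * C) := by
    ext k l
    simp only [e, Matrix.diagonal_mul, Matrix.mul_diagonal, Matrix.smul_apply, smul_eq_mul,
      Pi.inv_apply]
    by_cases hkl : d k = d l
    · by_cases hki : d k = d i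
      · rw [hd l i (hkl ▸ hki)]; ring
      · simp [hki]
    · simp [hC k l hkl]
  have hxf : C * Matrix.diagonal τ⁻¹ * e j = (τ j)⁻¹ • (C * e j) := by
    ext k l
    simp only [e, Matrix.mul_diagonal, Matrix.smul_apply, smul_eq_mul, Pi.inv_apply]
    by_cases hlj : d l = d j
    · rw [hd l j hlj]; ring
    · simp [hlj]
  have heC' : e i * C = τ i • (e i * (C * Matrix.diagonal τ⁻¹)) := by
    rw [hex, smul_smul, mul_inv_cancel₀ (hτ i), one_smul]
  have key : C * (e i * Y * e j) = e i * Y * e j * ((τ i / τ j) • C) := by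
    calc C * (e i * Y * e j) = e i * C * Y * e j := by rw [heC]; simp only [mul_assoc]
      _ = τ i • (e i * (C * Matrix.diagonal τ⁻¹ * Y) * e j) := by
        rw [heC']; simp only [mul_assoc, smul_mul_assoc]
      _ = τ i • (e i * Y * (C * Matrix.diagonal τ⁻¹ * e j)) := by
        rw [← hY]; simp only [mul_assoc]
      _ = e i * Y * e j * ((τ i / τ j) • C) := by
        rw [hxf, ← heC]
        simp only [mul_assoc, mul_smul_comm, smul_smul, div_eq_mul_inv]
  have hN : e i * Y * e j = 0 := by
    refine eq_zero_of_mul_eq_mul_of_disjoint_spectrum key ?_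
    refine Set.disjoint_left.2 fun y hy hy' => ?_
    have hu : IsUnit (τ i / τ j) := (div_ne_zero (hτ i) (hτ j)).isUnit
    obtain ⟨x, rfl⟩ : ∃ x, hu.unit • x = y := ⟨hu.unit⁻¹ • y, smul_inv_smul _ _⟩
    refine hgen i j hij x (spectrum.smul_mem_smul_iff (r := hu.unit).1 hy') _ hy ?_
    rw [Units.smul_def, hu.unit_spec, smul_eq_mul]
    field_simp [hτ j]
  have := congrFun (congrFun hN i) j
  simpa [e, Matrix.mul_diagonal, Matrix.diagonal_mul] using this

/-! ### Generic elements of a torus -/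

/-- The `i`-th diagonal entry of `b * g * b⁻¹`. When `b` diagonalizes a torus, these are the weights
of the torus. -/
def weight (b g : GL (Fin n) ℂ) (i : Fin n) : ℂ := ((b * g * b⁻¹ : GL (Fin n) ℂ) : Mat n) i i

theorem conj_eq_diagonal {b g : GL (Fin n) ℂ}
    (h : ((b * g * b⁻¹ : GL (Fin n) ℂ) : Mat n).IsDiag) :
    ((b * g * b⁻¹ : GL (Fin n) ℂ) : Mat n) = Matrix.diagonal (weight b g) :=
  h.diagonal_diag.symm

theorem weight_ne_zero {b g : GL (Fin n) ℂ}
    (h : ((b * g * b⁻¹ : GL (Fin n) ℂ) : Mat n).IsDiag) (i : Fin n) : weight b g i ≠ 0 := by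
  have hdet := ((Matrix.isUnit_iff_isUnit_det _).1 (b * g * b⁻¹).isUnit).ne_zero
  rw [conj_eq_diagonal h, Matrix.det_diagonal] at hdet
  exact Finset.prod_ne_zero_iff.1 hdet i (Finset.mem_univ i)

theorem commute_iff_conj {b x y : GL (Fin n) ℂ} :
    x * y = y * x ↔ ((b * x * b⁻¹ : GL (Fin n) ℂ) : Mat n) * ((b * y * b⁻¹ : GL (Fin n) ℂ) : Mat n) =
      ((b * y * b⁻¹ : GL (Fin n) ℂ) : Mat n) * ((b * x * b⁻¹ : GL (Fin n) ℂ) : Mat n) := by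
  rw [← Units.val_mul, ← Units.val_mul, Units.val_inj]
  have h : ∀ x y : GL (Fin n) ℂ, b * x * b⁻¹ * (b * y * b⁻¹) = b * (x * y) * b⁻¹ := fun x y => by
    group
  rw [h, h, mul_left_inj, mul_right_inj]

/-- The centralizer of a diagonalizable group consists of the matrices which are block diagonal with
respect to its weights. -/
theorem mem_centralizer_iff_of_isDiag {Z : Subgroup (GL (Fin n) ℂ)} {b : GL (Fin n) ℂ}
    (hb : ∀ z ∈ Z, ((b * z * b⁻¹ : GL (Fin n) ℂ) : Mat n).IsDiag) {g : GL (Fin n) ℂ} :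
    g ∈ Subgroup.centralizer (Z : Set (GL (Fin n) ℂ)) ↔
      ∀ i j, (fun z : Z => weight b z i) ≠ (fun z : Z => weight b z j) →
        ((b * g * b⁻¹ : GL (Fin n) ℂ) : Mat n) i j = 0 := by
  rw [Subgroup.mem_centralizer_iff]
  constructor
  · intro h i j hij
    obtain ⟨z, hz⟩ := Function.ne_iff.1 hij
    have := (commute_iff_conj (b := b)).1 (h z z.2)
    rw [conj_eq_diagonal (hb z z.2)] at this
    have := congrFun (congrFun this i) j
    rw [Matrix.diagonal_mul, Matrix.mul_diagonal, mul_comm, ← sub_eq_zero, ← mul_sub] at this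
    exact (mul_eq_zero.1 this).resolve_right (sub_ne_zero.2 hz)
  · intro h z hz
    rw [commute_iff_conj (b := b), conj_eq_diagonal (hb z hz)]
    ext i j
    rw [Matrix.diagonal_mul, Matrix.mul_diagonal, mul_comm]
    by_cases hij : (fun z : Z => weight b z i) = (fun z : Z => weight b z j)
    · rw [show weight b z i = weight b z j from congrFun hij ⟨z, hz⟩]
    · rw [h i j hij, zero_mul, zero_mul]

/-- If `c` centralizes the torus `Z`, then for generic `t ∈ Z` the centralizer of `c * t⁻¹` centralizes
`Z`. The conditions on `t` say that eigenvalues `x`, `y` of `c` remain different on different weight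
spaces of `Z` after the translation; each of them holds somewhere on `Z`, since otherwise evaluation
at `1` gives `x = y`, so that the two weights coincide. -/
theorem exists_isOpen_centralizer_le {Z : Subgroup (GL (Fin n) ℂ)} (hZ : IsTorus Z)
    {c : GL (Fin n) ℂ} (hc : c ∈ Subgroup.centralizer (Z : Set (GL (Fin n) ℂ))) :
    ∃ O : Set (GL (Fin n) ℂ), IsOpen[zariski n] O ∧ ((Z : Set (GL (Fin n) ℂ)) ∩ O).Nonempty ∧
      ∀ t ∈ (Z : Set (GL (Fin n) ℂ)) ∩ O, ∀ g, g * (c * t⁻¹) = c * t⁻¹ * g →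
        g ∈ Subgroup.centralizer (Z : Set (GL (Fin n) ℂ)) := by
  let := zariski n
  obtain ⟨-, hconn, b, hb⟩ := hZ
  set C : Mat n := ((b * c * b⁻¹ : GL (Fin n) ℂ) : Mat n) with hC
  let d : Fin n → Z → ℂ := fun i z => weight b z i
  have : Finite (spectrum ℂ C) := Matrix.finite_spectrum C
  let I := {a : Fin n × Fin n × spectrum ℂ C × spectrum ℂ C // d a.1 ≠ d a.2.1}
  let V : I → Set (GL (Fin n) ℂ) := fun a =>
    {t | weight b t a.1.1 * a.1.2.2.1 - weight b t a.1.2.1 * a.1.2.2.2 ≠ 0}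
  have hVo : ∀ a, IsOpen (V a) := fun a => by
    obtain ⟨q, hq⟩ := exists_evalAt_mul_mul (b : Mat n) ((b⁻¹ : GL (Fin n) ℂ) : Mat n)
      (.X (a.1.1, a.1.1) * .C a.1.2.2.1.1 - .X (a.1.2.1, a.1.2.1) * .C a.1.2.2.2.1)
    have := isOpen_zariski_ne q
    simp only [hq] at this
    simpa [evalAt, V, weight] using this
  have hVne : ∀ a, ((Z : Set (GL (Fin n) ℂ)) ∩ V a).Nonempty := by
    rintro ⟨⟨i, j, ⟨x, hx⟩, ⟨y, hy⟩⟩, hij⟩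
    by_contra hemp
    have h : ∀ z ∈ Z, weight b z i * x = weight b z j * y := fun z hz => by
      by_contra hne
      exact hemp ⟨z, hz, sub_ne_zero.2 hne⟩
    have hxy : x = y := by simpa [weight] using h 1 Z.one_mem
    subst hxy
    have hx0 : x ≠ 0 := by
      rintro rfl
      exact (spectrum.zero_mem_iff ℂ).1 hx (b * c * b⁻¹).isUnit
    exact hij (funext fun z => mul_right_cancel₀ hx0 (h z z.2))
  have hZirr : IsIrreducible (Z : Set (GL (Fin n) ℂ)) := ⟨⟨1, Z.one_mem⟩, hconn.isPreirreducible⟩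
  refine ⟨⋂ a, V a, isOpen_iInter_of_finite hVo, ?_, ?_⟩
  · have := isIrreducible_iff_sInter.1 hZirr (Set.finite_range V).toFinset
      (by simpa using hVo) (by simpa using hVne)
    simpa using this
  · rintro t ⟨htZ, ht⟩ g hg
    rw [mem_centralizer_iff_of_isDiag hb]
    intro i j hij
    refine apply_eq_zero_of_commute d (weight_ne_zero (hb t htZ))
      (fun i j h => congrFun h ⟨t, htZ⟩) ((mem_centralizer_iff_of_isDiag hb).1 hc) ?_ ?_ hij
    · intro i j hij x hx y hy
      exact sub_ne_zero.1 (Set.mem_iInter.1 ht ⟨⟨i, j, ⟨x, hx⟩, ⟨y, hy⟩⟩, hij⟩)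
    · have hinv : Matrix.diagonal (weight b t)⁻¹ = ((b * t⁻¹ * b⁻¹ : GL (Fin n) ℂ) : Mat n) := by
        rw [show b * t⁻¹ * b⁻¹ = (b * t * b⁻¹)⁻¹ by group]
        refine (Units.inv_eq_of_mul_eq_one_right ?_).symm
        rw [conj_eq_diagonal (hb t htZ), Matrix.diagonal_mul_diagonal]
        simp [weight_ne_zero (hb t htZ)]
      rw [hinv, ← Units.val_mul, show b * c * b⁻¹ * (b * t⁻¹ * b⁻¹) = b * (c * t⁻¹) * b⁻¹ by group]
      exact commute_iff_conj.1 hg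

/-- Generic elements of `Z` satisfy the conditions for `c = 1`, giving the centralizer of `t`, and for
one representative `c` of the conjugacy class, which suffices as `H` commutes with `t`. -/
theorem exists_isOpenDenseIn_centralizerIn {G H Z : Subgroup (GL (Fin n) ℂ)}
    {C : Set (GL (Fin n) ℂ)} (hZ : IsTorus Z)
    (hH : centralizerIn G (Z : Set (GL (Fin n) ℂ)) = H) (hC : IsConjClassOf H C) :
    ∃ U : Set (GL (Fin n) ℂ), IsOpenDenseIn U (Z : Set (GL (Fin n) ℂ)) ∧
      ∀ t ∈ U, centralizerIn G {t} = H ∧ ∀ h ∈ C, centralizerIn G {h * t⁻¹} ≤ H := by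
  let := zariski n
  obtain ⟨c, hcH, rfl⟩ := hC
  subst hH
  obtain ⟨O, hO, hOne, hOc⟩ := exists_isOpen_centralizer_le hZ hcH.2
  obtain ⟨O₁, hO₁, hOne₁, hOc₁⟩ := exists_isOpen_centralizer_le hZ (one_mem _)
  have hirr := hZ.2.1.isPreirreducible
  refine ⟨(Z : Set (GL (Fin n) ℂ)) ∩ (O ∩ O₁), ⟨⟨_, hO.inter hO₁, rfl⟩,
    subset_closure_inter_of_isPreirreducible_of_isOpen hirr (hO.inter hO₁)
      (hirr _ _ hO hO₁ hOne hOne₁)⟩, ?_⟩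
  rintro t ⟨htZ, htO, htO₁⟩
  constructor
  · refine le_antisymm (fun g hg => ⟨hg.1, hOc₁ t ⟨htZ, htO₁⟩ g ?_⟩)
      (inf_le_inf le_rfl (Subgroup.centralizer_le (Set.singleton_subset_iff.2 htZ)))
    have hgt : t * g = g * t := Subgroup.mem_centralizer_iff.1 hg.2 t rfl
    rw [one_mul]
    exact (Commute.inv_right (show Commute g t from hgt.symm)).eq
  · rintro _ ⟨k, hk, rfl⟩ g hg
    have hgx : k * c * k⁻¹ * t⁻¹ * g = g * (k * c * k⁻¹ * t⁻¹) :=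
      Subgroup.mem_centralizer_iff.1 hg.2 _ rfl
    have hkt : k⁻¹ * t⁻¹ = t⁻¹ * k⁻¹ := by
      rw [← mul_inv_rev, ← mul_inv_rev, Subgroup.mem_centralizer_iff.1 hk.2 t htZ]
    -- as `k` commutes with `t`, conjugation by `k` reduces the claim to `c`
    have hmem : k⁻¹ * g * k ∈ centralizerIn G (Z : Set (GL (Fin n) ℂ)) := by
      refine ⟨G.mul_mem (G.mul_mem (G.inv_mem hk.1) hg.1) hk.1, hOc t ⟨htZ, htO⟩ _ ?_⟩
      have hx : k * c * k⁻¹ * t⁻¹ = k * (c * t⁻¹) * k⁻¹ := by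
        rw [mul_assoc _ k⁻¹, hkt]; group
      rw [hx] at hgx
      calc k⁻¹ * g * k * (c * t⁻¹) = k⁻¹ * (g * (k * (c * t⁻¹) * k⁻¹)) * k := by group
        _ = k⁻¹ * (k * (c * t⁻¹) * k⁻¹ * g) * k := by rw [hgx]
        _ = c * t⁻¹ * (k⁻¹ * g * k) := by group
    have := mul_mem (mul_mem hk hmem) (inv_mem hk)
    rwa [show k * (k⁻¹ * g * k) * k⁻¹ = g by group] at this

/-! ### Cocharacters -/

theorem matrix_polynomial_ext {P Q : Matrix (Fin n) (Fin n) (Polynomial ℂ)}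
    (h : ∀ z : ℂˣ, P.map (Polynomial.eval (z : ℂ)) = Q.map (Polynomial.eval (z : ℂ))) : P = Q := by
  ext1 i j
  refine Polynomial.eq_of_infinite_eval_eq _ _ (Set.Infinite.mono (s := {0}ᶜ) ?_ ?_)
  · intro z hz
    exact congrFun (congrFun (h (Units.mk0 z hz)) i) j
  · exact (Set.finite_singleton 0).infinite_compl

/-- Clearing denominators, `z ^ K • γ z` is polynomial in `z`. -/
theorem IsCocharacter.exists_polynomial {G : Subgroup (GL (Fin n) ℂ)} {γ : ℂˣ →* GL (Fin n) ℂ}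
    (hγ : IsCocharacter G γ) : ∃ (K : ℕ) (P : Matrix (Fin n) (Fin n) (Polynomial ℂ)),
      ∀ z : ℂˣ, P.map (Polynomial.eval (z : ℂ)) = (z : ℂ) ^ K • (γ z : Mat n) := by
  choose p k hp using hγ.2
  let K := Finset.univ.sup fun ij : Fin n × Fin n => k ij.1 ij.2
  refine ⟨K, Matrix.of fun i j => p i j * Polynomial.X ^ (K - k i j), fun z => ?_⟩
  ext i j
  have hk : k i j ≤ K :=
    Finset.le_sup (f := fun ij : Fin n × Fin n => k ij.1 ij.2) (Finset.mem_univ (i, j))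
  have hz : (z : ℂ) ≠ 0 := z.ne_zero
  simp only [Matrix.map_apply, Matrix.of_apply, Polynomial.eval_mul, Polynomial.eval_pow,
    Polynomial.eval_X, Matrix.smul_apply, smul_eq_mul, hp]
  rw [pow_sub₀ _ hz hk]
  field_simp

/-- The coefficients `M m` of a Laurent expansion `γ z = ∑ z ^ (m - K) M m` of a cocharacter have
columns in the weight spaces of `γ`, and commute with all matrices commuting with `γ`. -/
theorem IsCocharacter.exists_weight_projections {G : Subgroup (GL (Fin n) ℂ)}
    {γ : ℂˣ →* GL (Fin n) ℂ} (hγ : IsCocharacter G γ) :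
    ∃ (D : ℕ) (M : ℕ → Mat n) (χ : ℕ → ℂˣ → ℂ), ∑ m ∈ Finset.range D, M m = 1 ∧
      (∀ m z, (γ z : Mat n) * M m = χ m z • M m) ∧
      ∀ A : Mat n, (∀ z, A * (γ z : Mat n) = (γ z : Mat n) * A) → ∀ m, A * M m = M m * A := by
  obtain ⟨K, P, hP⟩ := hγ.exists_polynomial
  have hleft : ∀ (A : Mat n) (Q : Matrix (Fin n) (Fin n) (Polynomial ℂ)) (m : ℕ),
      (A.map Polynomial.C * Q).map (Polynomial.coeff · m) = A * Q.map (Polynomial.coeff · m) := by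
    intro A Q m
    ext i j
    simp [Matrix.mul_apply]
  have hright : ∀ (A : Mat n) (Q : Matrix (Fin n) (Fin n) (Polynomial ℂ)) (m : ℕ),
      (Q * A.map Polynomial.C).map (Polynomial.coeff · m) = Q.map (Polynomial.coeff · m) * A := by
    intro A Q m
    ext i j
    simp [Matrix.mul_apply]
  have hevl : ∀ (A : Mat n) (Q : Matrix (Fin n) (Fin n) (Polynomial ℂ)) (z : ℂ),
      (A.map Polynomial.C * Q).map (Polynomial.eval z) = A * Q.map (Polynomial.eval z) := by
    intro A Q m
    ext i j
    simp [Matrix.mul_apply, Polynomial.eval_finsetSum]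
  have hevr : ∀ (A : Mat n) (Q : Matrix (Fin n) (Fin n) (Polynomial ℂ)) (z : ℂ),
      (Q * A.map Polynomial.C).map (Polynomial.eval z) = Q.map (Polynomial.eval z) * A := by
    intro A Q m
    ext i j
    simp [Matrix.mul_apply, Polynomial.eval_finsetSum]
  refine ⟨Finset.univ.sup (fun ij : Fin n × Fin n => (P ij.1 ij.2).natDegree) + 1,
    fun m => P.map (Polynomial.coeff · m), fun m z => (z : ℂ) ^ m / (z : ℂ) ^ K, ?_, ?_, ?_⟩
  · have h1 := hP 1
    simp only [Units.val_one, one_pow, one_smul, map_one] at h1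
    rw [← h1]
    ext i j
    have hdeg : (P i j).natDegree ≤
        Finset.univ.sup (fun ij : Fin n × Fin n => (P ij.1 ij.2).natDegree) :=
      Finset.le_sup (f := fun ij : Fin n × Fin n => (P ij.1 ij.2).natDegree) (Finset.mem_univ (i, j))
    rw [Matrix.map_apply, Polynomial.eval_eq_sum_range' (Nat.lt_succ_of_le hdeg)]
    simp [Matrix.sum_apply]
  · intro m z
    have hz : (z : ℂ) ^ K ≠ 0 := pow_ne_zero _ z.ne_zero
    -- the coefficients at `w ^ m` of the identity `z ^ K γ z (w ^ K γ w) = (z w) ^ K γ (z w)`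
    have h : ((z : ℂ) ^ K • (γ z : Mat n)).map Polynomial.C * P =
        P.map fun p => p.comp (Polynomial.C (z : ℂ) * Polynomial.X) := by
      refine matrix_polynomial_ext fun w => ?_
      rw [hevl, hP]
      have hzw := hP (z * w)
      ext i j
      have := congrFun (congrFun hzw i) j
      simp only [Matrix.map_apply, Units.val_mul, map_mul] at this
      simp only [Matrix.map_apply, Polynomial.eval_comp, Polynomial.eval_mul, Polynomial.eval_C,
        Polynomial.eval_X, this]
      rw [smul_mul_smul_comm, mul_pow]
    have hm := congrArg (fun Q => Q.map (Polynomial.coeff · m)) h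
    simp only [hleft] at hm
    have hcomp : (P.map fun p => p.comp (Polynomial.C (z : ℂ) * Polynomial.X)).map
        (Polynomial.coeff · m) = (z : ℂ) ^ m • P.map (Polynomial.coeff · m) := by
      ext i j
      simp only [Matrix.map_apply, Matrix.smul_apply, smul_eq_mul, Polynomial.comp_C_mul_X_coeff]
      exact mul_comm _ _
    rw [hcomp, smul_mul_assoc] at hm
    change (γ z : Mat n) * P.map (Polynomial.coeff · m) =
      ((z : ℂ) ^ m / (z : ℂ) ^ K) • P.map (Polynomial.coeff · m)
    rw [div_eq_inv_mul, mul_smul, ← hm, inv_smul_smul₀ hz]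
  · intro A hA m
    have h : A.map Polynomial.C * P = P * A.map Polynomial.C :=
      matrix_polynomial_ext fun z => by rw [hevl, hevr, hP, mul_smul_comm, hA, smul_mul_assoc]
    have hm := congrArg (fun Q => Q.map (Polynomial.coeff · m)) h
    simpa only [hleft, hright] using hm

/-- The image of `ℂˣ` is the image of `ℂ` under the composition of `γ` with the exponential map, which
is continuous from the classical to the Zariski topology. -/
theorem IsCocharacter.isConnectedGroup_range {G : Subgroup (GL (Fin n) ℂ)}
    {γ : ℂˣ →* GL (Fin n) ℂ} (hγ : IsCocharacter G γ) : IsConnectedGroup γ.range := by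
  let f : ℂ → GL (Fin n) ℂ := fun w => γ (Units.mk0 (Complex.exp w) (Complex.exp_ne_zero w))
  have hf : Continuous[inferInstance, zariski n] f := by
    refine continuous_zariski_of_forall fun p => ?_
    have hcont : Continuous fun w => evalAt (f w : Mat n) p := by
      refine (MvPolynomial.continuous_eval p).comp (continuous_pi fun ij => ?_)
      obtain ⟨q, k, hq⟩ := hγ.2 ij.1 ij.2
      simp only [f, hq, Units.val_mk0]
      exact (q.continuous.comp Complex.continuous_exp).div (Complex.continuous_exp.pow k)
        fun w => pow_ne_zero _ (Complex.exp_ne_zero w)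
    exact isOpen_ne_fun hcont continuous_const
  have hrange : (γ.range : Set (GL (Fin n) ℂ)) = Set.range f := by
    ext g
    constructor
    · rintro ⟨z, rfl⟩
      refine ⟨Complex.log z, ?_⟩
      simp only [f]
      congr 1
      ext
      simp [Complex.exp_log z.ne_zero]
    · rintro ⟨w, rfl⟩
      exact ⟨_, rfl⟩
  rw [IsConnectedGroup, hrange]
  exact @isConnected_range _ _ _ (zariski n) _ _ hf

/-- Matrices with a common spanning set of eigenvectors are simultaneously diagonalizable. -/
theorem exists_isDiag_of_span_eq_top (S : Set (GL (Fin n) ℂ)) (W : Set (Fin n → ℂ))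
    (hW : Submodule.span ℂ W = ⊤)
    (hS : ∀ w ∈ W, ∀ s ∈ S, ∃ μ : ℂ, (s : Mat n).mulVec w = μ • w) :
    ∃ b : GL (Fin n) ℂ, ∀ s ∈ S, ((b * s * b⁻¹ : GL (Fin n) ℂ) : Mat n).IsDiag := by
  obtain ⟨B, hBW, hBspan, hBind⟩ := exists_linearIndependent ℂ W
  let v₀ : Module.Basis B ℂ (Fin n → ℂ) := Module.Basis.mk hBind (by
    rw [Subtype.range_coe, hBspan, hW])
  let v := v₀.reindex (v₀.indexEquiv (Pi.basisFun ℂ (Fin n)))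
  have hvW : ∀ i, v i ∈ W := fun i => by
    simp only [v, v₀, Module.Basis.reindex_apply, Module.Basis.mk_apply]
    exact hBW (Subtype.coe_prop _)
  let : Invertible ((Pi.basisFun ℂ (Fin n)).toMatrix v) := Module.Basis.invertibleToMatrix _ _
  let a : GL (Fin n) ℂ := unitOfInvertible ((Pi.basisFun ℂ (Fin n)).toMatrix v)
  have ha : ∀ i j, (a : Mat n) i j = v j i := fun i j => by
    simp [a, Module.Basis.toMatrix_apply]
  refine ⟨a⁻¹, fun s hs => ?_⟩
  choose μ hμ using fun i => hS (v i) (hvW i) s hs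
  have h : (s : Mat n) * (a : Mat n) = (a : Mat n) * Matrix.diagonal μ := by
    ext i j
    have := congrFun (hμ j) i
    rw [Matrix.mul_diagonal, ha, mul_comm, Matrix.mul_apply]
    simpa only [Matrix.mulVec, dotProduct, Pi.smul_apply, smul_eq_mul, ha] using this
  rw [inv_inv, mul_assoc, Units.val_mul, Units.val_mul, h, Units.inv_mul_cancel_left]
  exact Matrix.isDiag_diagonal μ

/-- A diagonalizable group and a cocharacter commuting with it are simultaneously diagonalizable:
the weight projections of the cocharacter carry a basis of eigenvectors of the group to a spanning
set of common eigenvectors. -/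
theorem IsCocharacter.exists_isDiag {G T : Subgroup (GL (Fin n) ℂ)} {γ : ℂˣ →* GL (Fin n) ℂ}
    (hγ : IsCocharacter G γ) (hT : ∃ b : GL (Fin n) ℂ, ∀ s ∈ T,
      ((b * s * b⁻¹ : GL (Fin n) ℂ) : Mat n).IsDiag) (hTγ : ∀ t ∈ T, ∀ z, t * γ z = γ z * t) :
    ∃ b : GL (Fin n) ℂ, ∀ t ∈ T, ∀ z, ((b * (t * γ z) * b⁻¹ : GL (Fin n) ℂ) : Mat n).IsDiag := by
  obtain ⟨b, hb⟩ := hT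
  obtain ⟨D, M, χ, hsum, hMγ, hMA⟩ := hγ.exists_weight_projections
  let b' : Mat n := ((b⁻¹ : GL (Fin n) ℂ) : Mat n)
  let w : ℕ → Fin n → Fin n → ℂ := fun m i => (M m).mulVec (b'.mulVec (Pi.single i 1))
  have hspan : Submodule.span ℂ {x | ∃ m i, x = w m i} = ⊤ := by
    rw [eq_top_iff]
    rintro x -
    have hx : x = ∑ i, (b : Mat n).mulVec x i • b'.mulVec (Pi.single i 1) := by
      calc x = b'.mulVec ((b : Mat n).mulVec x) := by simp [b', Matrix.mulVec_mulVec]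
        _ = b'.mulVec (∑ i, (b : Mat n).mulVec x i • Pi.single i 1) := by
          congr 1
          exact pi_eq_sum_univ' _
        _ = _ := by
          rw [Matrix.mulVec_sum]
          simp only [Matrix.mulVec_smul]
    rw [hx]
    refine Submodule.sum_mem _ fun i _ => Submodule.smul_mem _ _ ?_
    rw [← Matrix.one_mulVec (b'.mulVec (Pi.single i 1)), ← hsum, Matrix.sum_mulVec]
    exact Submodule.sum_mem _ fun m _ => Submodule.subset_span ⟨m, i, rfl⟩
  have heig : ∀ x ∈ {x | ∃ m i, x = w m i}, ∀ s ∈ {s | ∃ t ∈ T, ∃ z, s = t * γ z},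
      ∃ μ : ℂ, (s : Mat n).mulVec x = μ • x := by
    rintro _ ⟨m, i, rfl⟩ _ ⟨t, ht, z, rfl⟩
    have hti : (t : Mat n).mulVec (b'.mulVec (Pi.single i 1)) =
        weight b t i • b'.mulVec (Pi.single i 1) := by
      have h : (t : Mat n) * b' = b' * Matrix.diagonal (weight b t) := by
        rw [← conj_eq_diagonal (hb t ht), ← Units.val_mul, ← Units.val_mul]
        congr 1
        group
      rw [Matrix.mulVec_mulVec, h, ← Matrix.mulVec_mulVec, Matrix.diagonal_mulVec_single,
        ← Matrix.mulVec_smul]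
      congr 1
      ext
      simp [Pi.single_apply]
    have htM : (t : Mat n) * M m = M m * (t : Mat n) :=
      hMA _ (fun z => by rw [← Units.val_mul, ← Units.val_mul, hTγ t ht z]) m
    refine ⟨χ m z * weight b t i, ?_⟩
    simp only [w]
    rw [Matrix.mulVec_mulVec, Units.val_mul, mul_assoc, hMγ, mul_smul_comm, htM, Matrix.smul_mulVec,
      ← Matrix.mulVec_mulVec, hti, Matrix.mulVec_smul, smul_smul]
  obtain ⟨a, ha⟩ := exists_isDiag_of_span_eq_top _ _ hspan heig
  exact ⟨a, fun t ht z => ha _ ⟨t, ht, z, rfl⟩⟩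

/-- The subgroup generated by a maximal torus and a commuting cocharacter is connected and
diagonalizable, so its closure is a torus, and equal to `T` by maximality. -/
theorem IsMaximalTorus.cocharacter_mem {G T : Subgroup (GL (Fin n) ℂ)} {γ : ℂˣ →* GL (Fin n) ℂ}
    (hG : IsAlgebraic G) (hT : IsMaximalTorus G T) (hγ : IsCocharacter G γ)
    (hTγ : ∀ t ∈ T, ∀ z, t * γ z = γ z * t) (z : ℂˣ) : γ z ∈ T := by
  let := zariski n
  have : SeparatelyContinuousMul (GL (Fin n) ℂ) := separatelyContinuousMul_zariski
  let S : Subgroup (GL (Fin n) ℂ) :=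
    { carrier := {x | ∃ t ∈ T, ∃ z, x = t * γ z}
      one_mem' := ⟨1, T.one_mem, 1, by simp⟩
      mul_mem' := by
        rintro _ _ ⟨t, ht, z, rfl⟩ ⟨s, hs, w, rfl⟩
        refine ⟨t * s, T.mul_mem ht hs, z * w, ?_⟩
        rw [map_mul, mul_assoc, ← mul_assoc (γ z), ← hTγ s hs z]
        simp only [mul_assoc]
      inv_mem' := by
        rintro _ ⟨t, ht, z, rfl⟩
        exact ⟨t⁻¹, T.inv_mem ht, z⁻¹, by rw [hTγ t ht z, mul_inv_rev, map_inv]⟩ }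
  have hTS : T ≤ S := fun t ht => ⟨t, ht, 1, by simp⟩
  have hSconn : IsConnected (S : Set (GL (Fin n) ℂ)) := by
    refine ⟨⟨1, S.one_mem⟩, isPreconnected_of_forall 1 ?_⟩
    rintro _ ⟨t, ht, z, rfl⟩
    have hγconn : IsPreconnected ((fun x => t * x) '' (γ.range : Set (GL (Fin n) ℂ))) :=
      hγ.isConnectedGroup_range.isPreconnected.image _ (continuous_const_mul t).continuousOn
    refine ⟨T ∪ (fun x => t * x) '' (γ.range : Set (GL (Fin n) ℂ)), ?_, Or.inl T.one_mem,
      Or.inr ⟨γ z, ⟨z, rfl⟩, rfl⟩, IsPreconnected.union t ht ⟨1, one_mem _, mul_one t⟩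
        hT.1.2.1.isPreconnected hγconn⟩
    rintro _ (hx | ⟨_, ⟨w, rfl⟩, rfl⟩)
    · exact hTS hx
    · exact ⟨t, ht, w, rfl⟩
  obtain ⟨b, hb⟩ := hγ.exists_isDiag hT.1.2.2 hTγ
  have htorus : IsTorus (zariskiClosure S) := by
    refine ⟨isAlgebraic_zariskiClosure S, hSconn.closure, b, ?_⟩
    refine zariskiClosure_subset (isClosed_zariski_isDiag b) ?_
    rintro _ ⟨t, ht, z, rfl⟩
    exact hb t ht z
  have hSG : zariskiClosure S ≤ G := by
    refine zariskiClosure_subset hG ?_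
    rintro _ ⟨t, ht, z, rfl⟩
    exact G.mul_mem (hT.2.1 ht) (hγ.1 z)
  rw [← hT.2.2 _ htorus hSG (hTS.trans (le_zariskiClosure S))]
  exact le_zariskiClosure S ⟨1, T.one_mem, z, by simp⟩

/-- The torus is the Zariski closure of the image of the cocharacter defining `H`. -/
theorem IsLeviOf.exists_isTorus {G T P H : Subgroup (GL (Fin n) ℂ)} (hG : IsAlgebraic G)
    (hT : IsMaximalTorus G T) (hH : IsLeviOf G P H) (hTH : T ≤ H) :
    ∃ Z : Subgroup (GL (Fin n) ℂ), IsTorus Z ∧ Z ≤ T ∧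
      centralizerIn G (Z : Set (GL (Fin n) ℂ)) = H := by
  let := zariski n
  obtain ⟨γ, hγ, -, rfl⟩ := hH
  have hTγ : ∀ t ∈ T, ∀ z, t * γ z = γ z * t := fun t ht z =>
    (Subgroup.mem_centralizer_iff.1 (hTH ht).2 (γ z) ⟨z, rfl⟩).symm
  have hle : zariskiClosure γ.range ≤ T := by
    refine zariskiClosure_subset hT.1.1 ?_
    rintro _ ⟨z, rfl⟩
    exact hT.cocharacter_mem hG hγ hTγ z
  obtain ⟨b, hb⟩ := hT.1.2.2
  refine ⟨zariskiClosure γ.range, ⟨isAlgebraic_zariskiClosure _,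
    hγ.isConnectedGroup_range.closure, b, fun s hs => hb s (hle hs)⟩, hle, ?_⟩
  rw [centralizerIn_zariskiClosure, MonoidHom.coe_range]

/-! ### Unfolding parameters -/

theorem exists_mem_of_isOpenDenseIn {Z : Subgroup (GL (Fin n) ℂ)} {U : Set (GL (Fin n) ℂ)}
    (hU : IsOpenDenseIn U (Z : Set (GL (Fin n) ℂ))) : ∃ t ∈ U, t ∈ Z := by
  obtain ⟨⟨O, -, rfl⟩, hd⟩ := hU
  obtain ⟨t, ht⟩ := (@closure_nonempty_iff _ (zariski n) _).1 ⟨1, hd Z.one_mem⟩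
  exact ⟨t, ht, ht.1⟩

theorem exists_unfolding_parameters {G T : Subgroup (GL (Fin n) ℂ)} {r : ℕ}
    {H Z : Fin (r + 1) → Subgroup (GL (Fin n) ℂ)} {C : Set (GL (Fin n) ℂ)}
    (hZ : ∀ i, IsTorus (Z i) ∧ Z i ≤ T ∧ centralizerIn G (Z i : Set (GL (Fin n) ℂ)) = H i)
    (hTH : T ≤ H 0) (hmono : Monotone H) (hC : IsConjClassOf (H 0) C) :
    ∃ t : Fin (r + 1) → GL (Fin n) ℂ, (∀ i, t i ∈ T ∧ centralizerIn G {t i} = H i) ∧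
      ∀ h ∈ C, centralizerIn G {h * ((List.ofFn t).prod)⁻¹} ≤ H 0 := by
  have hex : ∀ i, ∃ t ∈ Z i, centralizerIn G {t} = H i := fun i => by
    obtain ⟨U, hU, hUt⟩ := exists_isOpenDenseIn_centralizerIn (hZ i).1 (hZ i).2.2
      (C := {h | ∃ k ∈ H i, h = k * 1 * k⁻¹}) ⟨1, one_mem _, rfl⟩
    obtain ⟨t, htU, htZ⟩ := exists_mem_of_isOpenDenseIn hU
    exact ⟨t, htZ, (hUt t htU).1⟩
  choose t htZ ht using hex
  set s := (List.ofFn fun i : Fin r => t i.succ).prod with hs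
  have hsT : s ∈ T := by
    refine list_prod_mem fun x hx => ?_
    obtain ⟨i, rfl⟩ := List.mem_ofFn.1 hx
    exact (hZ i.succ).2.1 (htZ i.succ)
  have hsH : s ∈ Subgroup.centralizer (H 0 : Set (GL (Fin n) ℂ)) := by
    refine list_prod_mem fun x hx => ?_
    obtain ⟨i, rfl⟩ := List.mem_ofFn.1 hx
    refine Subgroup.mem_centralizer_iff.2 fun k hk => ?_
    have hk' : k ∈ centralizerIn G (Z i.succ : Set (GL (Fin n) ℂ)) :=
      (hZ i.succ).2.2 ▸ hmono (Fin.zero_le _) hk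
    exact (Subgroup.mem_centralizer_iff.1 hk'.2 _ (htZ i.succ)).symm
  obtain ⟨c, hc, rfl⟩ := hC
  -- `s` is central in `H 0`, so that translation by `s⁻¹` gives another conjugacy class of `H 0`
  obtain ⟨U, hU, hUt⟩ := exists_isOpenDenseIn_centralizerIn (hZ 0).1 (hZ 0).2.2
    (C := {h | ∃ k ∈ H 0, h = k * (c * s⁻¹) * k⁻¹})
    ⟨c * s⁻¹, mul_mem hc (inv_mem (hTH hsT)), rfl⟩
  obtain ⟨t₀, ht₀U, ht₀Z⟩ := exists_mem_of_isOpenDenseIn hU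
  refine ⟨Fin.cons t₀ fun i => t i.succ, ?_, ?_⟩
  · refine Fin.cases ?_ fun i => ?_
    · exact ⟨(hZ 0).2.1 ht₀Z, (hUt t₀ ht₀U).1⟩
    · exact ⟨(hZ i.succ).2.1 (htZ i.succ), ht i.succ⟩
  · rintro _ ⟨k, hk, rfl⟩
    have hks : k⁻¹ * s⁻¹ = s⁻¹ * k⁻¹ := by
      rw [← mul_inv_rev, ← mul_inv_rev, Subgroup.mem_centralizer_iff.1 hsH k hk]
    have hprod : (List.ofFn (Fin.cons t₀ fun i => t i.succ : Fin (r + 1) → GL (Fin n) ℂ)).prod =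
        t₀ * s := by
      simp [List.ofFn_succ, hs]
    rw [hprod, mul_inv_rev]
    have := (hUt t₀ ht₀U).2 (k * (c * s⁻¹) * k⁻¹) ⟨k, hk, rfl⟩
    rwa [show k * (c * s⁻¹) * k⁻¹ * t₀⁻¹ = k * c * k⁻¹ * (s⁻¹ * t₀⁻¹) by
      rw [← mul_assoc _ s⁻¹, mul_assoc _ k⁻¹ s⁻¹, hks]; group] at this

end AlgGrp

theorem propositionA2 (n : ℕ) (G T : Subgroup (GL (Fin n) ℂ))
    (hG : AlgGrp.IsReductive G) (hT : AlgGrp.IsMaximalTorus G T) :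
    -- generic elements of `Z` satisfy both conditions
    (∀ (P H Z : Subgroup (GL (Fin n) ℂ)) (C : Set (GL (Fin n) ℂ)),
      AlgGrp.IsParabolic G P → AlgGrp.IsLeviOf G P H → T ≤ H →
      AlgGrp.IsTorus Z → Z ≤ T → AlgGrp.centralizerIn G (Z : Set (GL (Fin n) ℂ)) = H →
      AlgGrp.IsConjClassOf H C →
      ∃ U : Set (GL (Fin n) ℂ),
        AlgGrp.IsOpenDenseIn U (Z : Set (GL (Fin n) ℂ)) ∧
        ∀ t ∈ U, AlgGrp.centralizerIn G {t} = H ∧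
          ∀ h ∈ C, AlgGrp.centralizerIn G {h * t⁻¹} ≤ H) ∧
    -- tori `Z` as above exist
    (∀ P H : Subgroup (GL (Fin n) ℂ),
      AlgGrp.IsParabolic G P → AlgGrp.IsLeviOf G P H → T ≤ H →
      ∃ Z : Subgroup (GL (Fin n) ℂ), AlgGrp.IsTorus Z ∧ Z ≤ T ∧
        AlgGrp.centralizerIn G (Z : Set (GL (Fin n) ℂ)) = H) ∧
    -- unfolding parameters exist
    (∀ (r : ℕ) (P H : Fin (r + 1) → Subgroup (GL (Fin n) ℂ)) (C : Set (GL (Fin n) ℂ)),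
      (∀ i, AlgGrp.IsParabolic G (P i) ∧ AlgGrp.IsLeviOf G (P i) (H i) ∧ T ≤ H i) →
      Monotone H → AlgGrp.IsConjClassOf (H 0) C →
      ∃ t : Fin (r + 1) → GL (Fin n) ℂ,
        (∀ i, t i ∈ T ∧ AlgGrp.centralizerIn G {t i} = H i) ∧
        ∀ h ∈ C, AlgGrp.centralizerIn G {h * ((List.ofFn t).prod)⁻¹} ≤ H 0) := by
  have hexists : ∀ P H : Subgroup (GL (Fin n) ℂ), AlgGrp.IsLeviOf G P H → T ≤ H →
      ∃ Z : Subgroup (GL (Fin n) ℂ), AlgGrp.IsTorus Z ∧ Z ≤ T ∧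
        AlgGrp.centralizerIn G (Z : Set (GL (Fin n) ℂ)) = H :=
    fun P H hH hTH => hH.exists_isTorus hG.1 hT hTH
  refine ⟨fun P H Z C _ _ _ hZ _ hH hC => AlgGrp.exists_isOpenDenseIn_centralizerIn hZ hH hC,
    fun P H _ => hexists P H, fun r P H C hP hmono hC => ?_⟩
  choose Z hZ using fun i => hexists (P i) (H i) (hP i).2.1 (hP i).2.2
  exact AlgGrp.exists_unfolding_parameters hZ (hP 0).2.2 hmono hC
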